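/- Let $\mathcal U$ be a nonprincipal ultrafilter on $\mathbb N$, and for a set $X$ let ${}^*X = X^{\mathbb N}/\mathcal U$. A subset of ${}^*\mathbb R$ is internal if it has the form $\{[x_i] : \{i : x_i\in B_i\}\in\mathcal U\}$ for some sequence of sets $B_i\subseteq\mathbb R$. For an infinite $N\in{}^*\mathbb N\setminus\mathbb N$ let $\Omega=\Omega_N=\{0,\tfrac1N,\dots,\tfrac NN\}\subseteq{}^*\mathbb R$, and for $A\subseteq[0,1]$ let $\mathrm{st}^{-1}(A)=\{x\in\Omega : \mathrm{st}(x)\in A\}$, where $\mathrm{st}$ is the standard part map. Let $s\in[0,1]$. For $\delta\in{}^*\mathbb R$, $\delta>0$, a $\delta$-interval of $\Omega$ is a set $V=\{\tfrac iN,\tfrac{i+1}N,\dots,\tfrac jN\}$ with $0\le i\le j\le N$ in ${}^*\mathbb N$ whose diameter, defined as $\operatorname{diam}(V)=\tfrac{j-i+1}N$, is at most $\delta$. For an internal set $B\subseteq\Omega$ put $$h_\delta^s(B)=\min\sum_{k=1}^{L}\operatorname{diam}(V_k)^s,$$ the minimum being over all internal hyperfinite partitions $\{V_1,\dots,V_L\}$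 ($L\in{}^*\mathbb N$) of $B$ into $\delta$-intervals of $\Omega$, with $h_\delta^s(B)=\infty$ if there is no such partition, and let $\mathrm{st}\,h_\delta^s(B)\in[0,\infty]$ be its standard part, equal to $\infty$ if $h_\delta^s(B)$ is infinite. Let $H^s$ be the $s$-dimensional Hausdorff outer measure on $\mathbb R$, that is, $H^s(A)=\sup_{\delta>0}\inf\sum_{i\in\mathbb N}\operatorname{diam}(U_i)^s$, where the infimum is over all countable covers $(U_i)$ of $A$ with $\operatorname{diam}(U_i)\le\delta$ for all $i$ (for $s=0$ with the conventions $\operatorname{diam}(\emptyset)^0=0$ and $\operatorname{diam}(\{x\})^0=1$, so that $H^0$ is the counting measure). Then for every $A\subseteq[0,1]$ and every infinite $N\in{}^*\mathbb N$: (a) for every positive infinitesimal $\delta\in{}^*\mathbb R$, $$H^s(A)\le\inf\{\mathrm{st}\,h_\delta^s(B) : B\subseteq\Omega\text{ internal},\ B\supseteq\mathrm{st}^{-1}(A)\};$$ (b) $$H^s(A)=\lim_{\delta\to0^+}\inf\{\mathrm{st}\,h_\delta^s(B) : B\subseteq\Omega\text{ internal},\ B\supseteq\mathrm{st}^{-1}(A)\},$$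 where $\delta$ ranges over the standard positive reals, and the limit exists in $[0,\infty]$. In particular, the limit in (b) does not depend on the choice of the infinite $N$. -/

import Mathlib

open Filter MeasureTheory Topology
open scoped ENNReal NNReal

namespace DiscreteHausdorff

/-! ### The finite grid and its discrete measure -/

/-- The grid `{0, 1/n, …, n/n}`. -/
def grid (n : ℕ) : Set ℝ := {x | ∃ k : ℕ, k ≤ n ∧ x = (k : ℝ) / n}

/-- The grid interval `{i/n, (i+1)/n, …, j/n}` coded by the pair `p = (i, j)`. -/
def gridInterval (n : ℕ) (p : ℕ × ℕ) : Set ℝ :=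
  {x | ∃ k : ℕ, p.1 ≤ k ∧ k ≤ p.2 ∧ x = (k : ℝ) / n}

/-- The discrete diameter `(j - i + 1)/n` of the grid interval coded by `p = (i, j)`. -/
noncomputable def gridDiam (n : ℕ) (p : ℕ × ℕ) : ℝ := ((p.2 : ℝ) - p.1 + 1) / n

/-- The pairs `(i, j) ∈ P` code a partition of `B` into (nonempty) `δ`-intervals of the grid. -/
structure IsPartition (n : ℕ) (δ : ℝ) (B : Set ℝ) (P : Finset (ℕ × ℕ)) : Prop where
  interval : ∀ p ∈ P, p.1 ≤ p.2 ∧ p.2 ≤ n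
  diam_le : ∀ p ∈ P, gridDiam n p ≤ δ
  disjoint : ∀ p ∈ P, ∀ q ∈ P, p ≠ q → Disjoint (gridInterval n p) (gridInterval n q)
  cover : (⋃ p ∈ P, gridInterval n p) = B

/-- The discrete `s`-dimensional measure of a subset `B` of the grid: the least value of
`∑ diam ^ s` over all partitions of `B` into `δ`-intervals. There are finitely many partitions, so
the infimum is a minimum (`exists_discreteMeasure_eq`), except that it is `∞` if `B` has no
partition into `δ`-intervals (that is, if `B` is nonempty and `δ < 1/n`). -/
noncomputable def discreteMeasure (s : ℝ) (n : ℕ) (δ : ℝ) (B : Set ℝ) : ℝ≥0∞ :=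
  ⨅ (P : Finset (ℕ × ℕ)) (_ : IsPartition n δ B P), ∑ p ∈ P, ENNReal.ofReal (gridDiam n p) ^ s

theorem exists_discreteMeasure_eq (s : ℝ) (n : ℕ) (δ : ℝ) (B : Set ℝ)
    (h : ∃ P, IsPartition n δ B P) :
    ∃ P, IsPartition n δ B P ∧
      discreteMeasure s n δ B = ∑ p ∈ P, ENNReal.ofReal (gridDiam n p) ^ s := by
  have hfin : {P | IsPartition n δ B P}.Finite := by
    refine ((Finset.range (n + 1) ×ˢ Finset.range (n + 1)).powerset.finite_toSet).subset ?_
    intro P hP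
    simp only [Finset.coe_powerset, Set.mem_preimage, Set.mem_powerset_iff, Finset.coe_subset]
    intro p hp
    have := hP.interval p hp
    simp only [Finset.mem_product, Finset.mem_range]
    omega
  obtain ⟨P, hP, hmin⟩ := hfin.exists_minimalFor
    (fun P => ∑ p ∈ P, ENNReal.ofReal (gridDiam n p) ^ s) _ h
  refine ⟨P, hP, le_antisymm (iInf₂_le P hP) (le_iInf₂ fun Q hQ => ?_)⟩
  exact (le_total _ _).elim id fun hle => hmin hQ hle

/-! ### The nonstandard extension by an ultrafilter on `ℕ`

For a set `X`, the nonstandard extension `*X` is the ultrapower `Germ U X`. Functions and relations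
are extended componentwise. -/

variable {U : Ultrafilter ℕ}

/-- The internal set with components `B₀, B₁, …`: the set of all `[x₀, x₁, …]` such that
`xᵢ ∈ Bᵢ` for `U`-almost all `i`. Thus the elements of `Germ U (Set ℝ)` represent the internal
subsets of `*ℝ`. -/
def internalSet (B : Germ (U : Filter ℕ) (Set ℝ)) : Set (Germ (U : Filter ℕ) ℝ) :=
  {x | Germ.LiftRel (fun (y : ℝ) (C : Set ℝ) => y ∈ C) x B}

/-- `N` is an infinite hypernatural number. -/
def IsInfinite (N : Germ (U : Filter ℕ) ℕ) : Prop :=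
  ∀ n : ℕ, (Germ.const n : Germ (U : Filter ℕ) ℕ) < N

/-- `δ` is a positive infinitesimal. -/
def IsPosInfinitesimal (δ : Germ (U : Filter ℕ) ℝ) : Prop :=
  0 < δ ∧ ∀ r : ℝ, 0 < r → δ < (Germ.const r : Germ (U : Filter ℕ) ℝ)

/-- The hyperfinite grid `Ω = {0, 1/N, …, N/N} ⊆ *ℝ`. -/
def Omega (N : Germ (U : Filter ℕ) ℕ) : Set (Germ (U : Filter ℕ) ℝ) :=
  internalSet (N.map grid)

/-- `st⁻¹(A) ⊆ Ω`; all points of `Ω` are finite, so `stdPart` is the actual standard part there. -/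
noncomputable def stInv (N : Germ (U : Filter ℕ) ℕ) (A : Set ℝ) : Set (Germ (U : Filter ℕ) ℝ) :=
  {x | x ∈ Omega N ∧ ArchimedeanClass.stdPart x ∈ A}

/-- The internal measure `h_δ^s(B) ∈ *[0, ∞]`, the nonstandard extension of `discreteMeasure`. -/
noncomputable def starMeasure (s : ℝ) (N : Germ (U : Filter ℕ) ℕ) (δ : Germ (U : Filter ℕ) ℝ)
    (B : Germ (U : Filter ℕ) (Set ℝ)) : Germ (U : Filter ℕ) ℝ≥0∞ :=
  Germ.map₂ (fun (h : Set ℝ → ℝ≥0∞) C => h C) (Germ.map₂ (discreteMeasure s) N δ) B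

/-- The standard part `st x = inf {a ∈ ℝ : x ≤ a} ∈ [0, ∞]` of `x ∈ *[0, ∞]`; it is `∞` if `x` is
infinite. -/
noncomputable def st (x : Germ (U : Filter ℕ) ℝ≥0∞) : ℝ≥0∞ :=
  ⨅ (a : ℝ≥0) (_ : x ≤ (Germ.const (a : ℝ≥0∞) : Germ (U : Filter ℕ) ℝ≥0∞)), (a : ℝ≥0∞)

/-- `inf {st h_δ^s(B) : B ⊆ Ω internal, B ⊇ st⁻¹(A)}`. -/
noncomputable def outerValue (s : ℝ) (N : Germ (U : Filter ℕ) ℕ) (δ : Germ (U : Filter ℕ) ℝ)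
    (A : Set ℝ) : ℝ≥0∞ :=
  ⨅ (B : Germ (U : Filter ℕ) (Set ℝ)) (_ : internalSet B ⊆ Omega N)
    (_ : stInv N A ⊆ internalSet B), st (starMeasure s N δ B)

/-- The nonstandard version of the Hausdorff measure: the limit of `outerValue` as the standard
real `δ` tends to `0` from above. -/
noncomputable def nonstandardHausdorff (s : ℝ) (N : Germ (U : Filter ℕ) ℕ) (A : Set ℝ) : ℝ≥0∞ :=
  limUnder (𝓝[>] (0 : ℝ)) fun δ : ℝ => outerValue s N (Germ.const δ) A

end DiscreteHausdorff

namespace DiscreteHausdorff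

/-! ### Hausdorff contents and ultrafilter limits of families of intervals -/

/-! Both parts rest on two inequalities: the content at scale `r` is at most the outer value at `δ`
whenever `δ ≤ δ₀` for a standard `δ₀ < r` (`content_le_outerValue`), and the outer value at a
standard `δ > 0` is at most `μH[s] A` (`outerValue_le_hausdorffMeasure`). The supremum of the
contents over `r > 0` is `μH[s] A`, which gives (a) and the limit in (b), for every infinite `N`.

Lower bound. An internal `B` containing `st⁻¹(A)` contains, around each `x ∈ A`, all grid points
within some standard distance. Turning the grid intervals of cheap partitions of the components of
`B` into half-open real cells of the same diameter gives finite disjoint families that cover a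
neighbourhood of each `x ∈ A` for almost all indices. Their number is unbounded, so taking limits of
single cells need not give a countable cover. Instead, `A` is covered by countably many disjoint
dyadic intervals `J m`, each covered by the cells for almost all indices, and a cell is assigned to
the first `J m` that it meets. The cells assigned to `m` form an interval; let `c m` be the
ultralimit of their cost. Disjointness gives `∑ c m ≤ a`, where `a` bounds the costs. The ultralimit
of these intervals has content at most `c m`, because the cells at one suitable index, stretched by
a factor close to 1, already cover it.

Upper bound. Slightly enlarge the members of a countable cover of `A`, take their grid points, and
use only the first `i` members at index `i`. Nonprincipality brings every member in eventually, and
overlaps are removed without raising the cost. -/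

/-- The `s`-dimensional Hausdorff content at scale `r`, as an outer measure on `ℝ`. -/
noncomputable def content (s : ℝ) (r : ℝ≥0∞) : OuterMeasure ℝ :=
  OuterMeasure.mkMetric'.pre (fun t => Metric.ediam t ^ s) r

theorem content_le {s : ℝ} {r : ℝ≥0∞} {t : Set ℝ} (h : Metric.ediam t ≤ r) :
    content s r t ≤ Metric.ediam t ^ s :=
  OuterMeasure.mkMetric'.pre_le h

theorem hausdorffMeasure_eq_iSup_content (s : ℝ) (A : Set ℝ) :
    μH[s] A = ⨆ (r : ℝ≥0∞) (_ : 0 < r), content s r A := by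
  have h : (μH[s] : Measure ℝ).toOuterMeasure = OuterMeasure.mkMetric (fun d => d ^ s) :=
    Measure.mkMetric_toOuterMeasure _
  rw [← Measure.coe_toOuterMeasure, h]
  simp only [OuterMeasure.mkMetric, OuterMeasure.mkMetric', OuterMeasure.iSup_apply]
  rfl

/-- If a finite family of intervals covers `[a', b']`, then stretching it by a factor `L` covers
every subset of an interval `[a, b]` whose length is at most `L (b' - a')`. -/
theorem content_le_of_stretch {κ : Type*} {s : ℝ} (hs₀ : 0 ≤ s) (hs₁ : s ≤ 1) {ρ r : ℝ≥0∞}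
    {F : Finset κ} {I : κ → Set ℝ} (hI : ∀ p ∈ F, Metric.ediam (I p) ≤ ρ) {L : ℝ≥0} (hL : 1 ≤ L)
    (hr : L * ρ ≤ r) {a b a' b' : ℝ} (hab' : a' < b') (hlen : b - a ≤ L * (b' - a'))
    (hcov : Set.Icc a' b' ⊆ ⋃ p ∈ F, I p) {D : Set ℝ} (hD : D ⊆ Set.Icc a b) :
    content s r D ≤ L * ∑ p ∈ F, Metric.ediam (I p) ^ s := by
  have hpos : 0 < b' - a' := sub_pos.2 hab'
  set f : ℝ → ℝ := fun x => a + L * (x - a') with hf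
  have hlip : LipschitzWith L f := by
    refine LipschitzWith.of_dist_le_mul fun x y => ?_
    rw [Real.dist_eq, Real.dist_eq, hf]
    have : a + L * (x - a') - (a + L * (y - a')) = L * (x - y) := by ring
    simp only [this, abs_mul, NNReal.abs_eq, le_refl]
  have hL0 : (0 : ℝ) < L := lt_of_lt_of_le one_pos (by exact_mod_cast hL)
  have hDsub : D ⊆ ⋃ p ∈ F, f '' I p := by
    intro x hx
    obtain ⟨hax, hxb⟩ := hD hx
    have hy : a' + (x - a) / L ∈ Set.Icc a' b' := by
      constructor
      · have : 0 ≤ (x - a) / L := div_nonneg (by linarith) hL0.le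
        linarith
      · have : (x - a) / L ≤ b' - a' := by
          rw [div_le_iff₀ hL0]
          linarith [mul_comm (b' - a') (L : ℝ)]
        linarith
    obtain ⟨p, hp, hyp⟩ := Set.mem_iUnion₂.1 (hcov hy)
    refine Set.mem_iUnion₂.2 ⟨p, hp, _, hyp, ?_⟩
    simp only [hf]
    field_simp
    ring
  calc content s r D ≤ content s r (⋃ p ∈ F, f '' I p) := measure_mono hDsub
    _ ≤ ∑ p ∈ F, content s r (f '' I p) := measure_biUnion_finset_le _ _
    _ ≤ ∑ p ∈ F, L * Metric.ediam (I p) ^ s := by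
        refine Finset.sum_le_sum fun p hp => ?_
        have h1 : Metric.ediam (f '' I p) ≤ L * Metric.ediam (I p) := hlip.ediam_image_le _
        refine (content_le (h1.trans ((mul_le_mul_right (hI p hp) _).trans hr))).trans ?_
        refine (ENNReal.rpow_le_rpow h1 hs₀).trans ?_
        rw [ENNReal.mul_rpow_of_nonneg _ _ hs₀]
        refine mul_le_mul_left ?_ _
        calc (L : ℝ≥0∞) ^ s ≤ (L : ℝ≥0∞) ^ (1 : ℝ) :=
              ENNReal.rpow_le_rpow_of_exponent_le (by exact_mod_cast hL) hs₁
          _ = L := ENNReal.rpow_one _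
    _ = _ := by rw [Finset.mul_sum]

/-- The content of an ultrafilter limit of intervals, each covered by a finite family of small
sets, is at most the limit of the costs of these families. -/
theorem content_le_of_tendsto {ι κ : Type*} {U : Ultrafilter ι} {s : ℝ} (hs₀ : 0 ≤ s) (hs₁ : s ≤ 1)
    {ρ r : ℝ≥0∞} (hρ : ρ < r) {F : ι → Finset κ} {I : ι → κ → Set ℝ}
    (hord : ∀ᶠ i in (U : Filter ι), (⋃ p ∈ F i, I i p).OrdConnected)
    (hI : ∀ᶠ i in (U : Filter ι), ∀ p ∈ F i, Metric.ediam (I i p) ≤ ρ) {c : ℝ≥0∞}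
    (hc : Tendsto (fun i => ∑ p ∈ F i, Metric.ediam (I i p) ^ s) U (𝓝 c)) :
    content s r {x ∈ Set.Icc (0 : ℝ) 1 | ∀ᶠ i in (U : Filter ι), x ∈ ⋃ p ∈ F i, I i p} ≤ c := by
  set D := {x ∈ Set.Icc (0 : ℝ) 1 | ∀ᶠ i in (U : Filter ι), x ∈ ⋃ p ∈ F i, I i p} with hD
  rcases D.subsingleton_or_nontrivial with hsub | hnt
  · rcases D.eq_empty_or_nonempty with he | ⟨x, hx⟩
    · rw [he, measure_empty]; exact zero_le
    -- The bound `0 ^ s ≤ c` is not vacuous: for `s = 0` it says `1 ≤ c`, which holds since some set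
    -- of the family contains `x`.
    · refine (content_le (by simp [hsub.ediam_eq])).trans ?_
      rw [hsub.ediam_eq]
      refine ge_of_tendsto hc ?_
      filter_upwards [hx.2] with i hi
      obtain ⟨p, hp, -⟩ := Set.mem_iUnion₂.1 hi
      exact (ENNReal.rpow_le_rpow zero_le hs₀).trans
        (Finset.single_le_sum (f := fun p => Metric.ediam (I i p) ^ s) (fun _ _ => zero_le) hp)
  · have hne : D.Nonempty := hnt.nonempty
    have hbb : BddBelow D := ⟨0, fun x hx => hx.1.1⟩
    have hba : BddAbove D := ⟨1, fun x hx => hx.1.2⟩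
    set a := sInf D
    set b := sSup D
    have hDab : D ⊆ Set.Icc a b := fun x hx => ⟨csInf_le hbb hx, le_csSup hba hx⟩
    have hab : a < b := by
      obtain ⟨x, hx, y, hy, hxy⟩ := hnt.exists_lt
      exact (csInf_le hbb hx).trans_lt (hxy.trans_le (le_csSup hba hy))
    have key : ∀ L : ℝ≥0, 1 < L → L * ρ ≤ r → content s r D ≤ L * c := by
      intro L hL hLr
      have hL' : (1 : ℝ) < L := by exact_mod_cast hL
      -- Moving each endpoint inwards by less than this amount leaves a length greater than `(b - a)
      -- / L`.
      have hη : 0 < (b - a) * (1 - 1 / (L : ℝ)) / 2 := by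
        have : 1 / (L : ℝ) < 1 := by rw [div_lt_one (by linarith)]; exact hL'
        have h1 : 0 < b - a := sub_pos.2 hab
        have h2 : 0 < 1 - 1 / (L : ℝ) := by linarith
        positivity
      obtain ⟨a', ha', haa'⟩ := exists_lt_of_csInf_lt hne (lt_add_of_pos_right a hη)
      obtain ⟨b', hb', hbb'⟩ := exists_lt_of_lt_csSup hne (sub_lt_self b hη)
      have hlt : (b - a) * (1 / L) < b' - a' := by
        have : (b - a) * (1 - 1 / (L : ℝ)) = (b - a) - (b - a) * (1 / L) := by ring
        linarith
      have hab' : a' < b' := by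
        have : 0 ≤ (b - a) * (1 / (L : ℝ)) :=
          mul_nonneg (sub_pos.2 hab).le (by positivity)
        linarith
      have hlen : b - a ≤ L * (b' - a') := by
        have h := mul_le_mul_of_nonneg_left hlt.le (zero_le_one.trans hL'.le)
        have h0 : (L : ℝ) ≠ 0 := by positivity
        have : (L : ℝ) * ((b - a) * (1 / L)) = b - a := by field_simp
        linarith
      refine ge_of_tendsto (ENNReal.Tendsto.const_mul hc (Or.inr ENNReal.coe_ne_top)) ?_
      filter_upwards [hord, hI, ha'.2, hb'.2] with i h1 h2 h3 h4
      exact content_le_of_stretch hs₀ hs₁ h2 hL.le hLr hab' hlen (h1.out h3 h4) hDab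
    have hρ' : ρ ≠ ∞ := (hρ.trans_le le_top).ne
    have hcoe : Tendsto (fun L : ℝ≥0 => (L : ℝ≥0∞)) (𝓝[>] 1) (𝓝 1) :=
      (ENNReal.tendsto_coe.2 tendsto_id).mono_left nhdsWithin_le_nhds
    have hev : ∀ᶠ L : ℝ≥0 in 𝓝[>] 1, (L : ℝ≥0∞) * ρ ≤ r := by
      have h := ENNReal.Tendsto.mul_const hcoe (Or.inr hρ') (b := ρ)
      rw [one_mul] at h
      exact (h.eventually_lt_const hρ).mono fun _ => le_of_lt
    have hlim := ENNReal.Tendsto.mul_const hcoe (Or.inl one_ne_zero) (b := c)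
    rw [one_mul] at hlim
    refine ge_of_tendsto hlim ?_
    filter_upwards [hev, self_mem_nhdsWithin] with L h1 h2 using key L h2 h1

/-- Dyadic intervals are nested: the index at level `k` is the index at level `l` divided by `2 ^ (l
- k)`, rounded down. -/
theorem floor_two_pow_mul_eq_of_le {k l : ℕ} (hkl : k ≤ l) {x y : ℝ}
    (h : ⌊2 ^ l * x⌋₊ = ⌊2 ^ l * y⌋₊) : ⌊2 ^ k * x⌋₊ = ⌊2 ^ k * y⌋₊ := by
  have key : ∀ z : ℝ, ⌊2 ^ k * z⌋₊ = ⌊2 ^ l * z⌋₊ / 2 ^ (l - k) := by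
    intro z
    rw [← Nat.floor_div_natCast (K := ℝ)]
    congr 1
    push_cast
    rw [eq_div_iff (by positivity), mul_right_comm, ← pow_add, Nat.add_sub_cancel' hkl]
  rw [key, key, h]

/-- The half-open dyadic interval of level `k` and index `j`, intersected with `[0, 1]`. -/
def dyadic (k j : ℕ) : Set ℝ := {y ∈ Set.Icc (0 : ℝ) 1 | ⌊2 ^ k * y⌋₊ = j}

theorem dyadic_ordConnected (k j : ℕ) : (dyadic k j).OrdConnected := by
  refine ⟨fun x hx y hy z hz => ⟨⟨hx.1.1.trans hz.1, hz.2.trans hy.1.2⟩, le_antisymm ?_ ?_⟩⟩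
  · rw [← hy.2]
    exact Nat.floor_le_floor (mul_le_mul_of_nonneg_left hz.2 (by positivity))
  · rw [← hx.2]
    exact Nat.floor_le_floor (mul_le_mul_of_nonneg_left hz.1 (by positivity))

theorem exists_dyadic_subset {x r : ℝ} (hx : x ∈ Set.Icc (0 : ℝ) 1) (hr : 0 < r) :
    ∃ k, dyadic k ⌊2 ^ k * x⌋₊ ⊆ {z ∈ Set.Icc (0 : ℝ) 1 | |z - x| < r} := by
  obtain ⟨k, hk⟩ := exists_pow_lt_of_lt_one hr (by norm_num : (1 / 2 : ℝ) < 1)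
  refine ⟨k, fun y hy => ⟨hy.1, ?_⟩⟩
  have hp : (0 : ℝ) < 2 ^ k := by positivity
  have h1 := Nat.floor_le (mul_nonneg hp.le hx.1)
  have h2 := Nat.lt_floor_add_one (2 ^ k * x)
  have h3 := Nat.floor_le (mul_nonneg hp.le hy.1.1)
  have h4 := Nat.lt_floor_add_one (2 ^ k * y)
  rw [hy.2] at h3 h4
  have h5 : |2 ^ k * (y - x)| < 1 := by rw [abs_lt]; constructor <;> linarith
  rw [abs_mul, abs_of_pos hp] at h5
  have h6 : |y - x| < (1 / 2) ^ k := by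
    rw [one_div, inv_pow, ← one_div, lt_div_iff₀ hp]; linarith
  exact h6.trans hk

/-- A set that is locally covered by good intervals is covered by a disjoint sequence of good
intervals, if subsets of good sets are good. -/
theorem exists_disjoint_cover {good : Set ℝ → Prop} (hmono : ∀ s t, s ⊆ t → good t → good s)
    (hempty : good ∅) {A : Set ℝ} (hA : A ⊆ Set.Icc 0 1)
    (h : ∀ x ∈ A, ∃ r > 0, good {z ∈ Set.Icc (0 : ℝ) 1 | |z - x| < r}) :
    ∃ J : ℕ → Set ℝ, (∀ m, (J m).OrdConnected) ∧ Pairwise (fun l m => Disjoint (J l) (J m)) ∧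
      A ⊆ (⋃ m, J m) ∧ ∀ m, good (J m) := by
  classical
  -- The maximal good dyadic intervals. Nestedness makes distinct ones disjoint, and the least good
  -- level at a point yields one containing it.
  let T : ℕ × ℕ → Prop := fun q => good (dyadic q.1 q.2) ∧
    ∀ k < q.1, ∀ y ∈ dyadic q.1 q.2, ¬ good (dyadic k ⌊2 ^ k * y⌋₊)
  let K : ℕ × ℕ → Set ℝ := fun q => if T q then dyadic q.1 q.2 else ∅
  have hK : ∀ {q z}, z ∈ K q → T q ∧ z ∈ dyadic q.1 q.2 := by
    intro q z hz
    by_cases hq : T q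
    · exact ⟨hq, by simpa only [K, if_pos hq] using hz⟩
    · simp only [K, if_neg hq, Set.mem_empty_iff_false] at hz
  refine ⟨fun m => K m.unpair, fun m => ?_, fun l m hlm => ?_, fun x hx => ?_, fun m => ?_⟩
  · by_cases hq : T m.unpair
    · simpa only [K, if_pos hq] using dyadic_ordConnected _ _
    · simpa only [K, if_neg hq] using Set.ordConnected_empty
  · refine Set.disjoint_left.2 fun z hz hz' => hlm ?_
    obtain ⟨hT, hz⟩ := hK hz
    obtain ⟨hT', hz'⟩ := hK hz'
    have h1 : l.unpair.1 = m.unpair.1 := by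
      rcases lt_trichotomy l.unpair.1 m.unpair.1 with hlt | heq | hlt
      · exact absurd (hz.2.symm ▸ hT.1) (hT'.2 _ hlt z hz')
      · exact heq
      · exact absurd (hz'.2.symm ▸ hT'.1) (hT.2 _ hlt z hz)
    have h2 : l.unpair.2 = m.unpair.2 := by rw [← hz.2, ← hz'.2, h1]
    rw [← Nat.pair_unpair l, ← Nat.pair_unpair m, h1, h2]
  · have hex : ∃ k, good (dyadic k ⌊2 ^ k * x⌋₊) := by
      obtain ⟨r, hr, hg⟩ := h x hx
      obtain ⟨k, hk⟩ := exists_dyadic_subset (hA hx) hr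
      exact ⟨k, hmono _ _ hk hg⟩
    refine Set.mem_iUnion.2 ⟨Nat.pair (Nat.find hex) ⌊2 ^ Nat.find hex * x⌋₊, ?_⟩
    have hT : T (Nat.find hex, ⌊2 ^ Nat.find hex * x⌋₊) := by
      refine ⟨Nat.find_spec hex, fun k hk y hy => ?_⟩
      rw [floor_two_pow_mul_eq_of_le hk.le hy.2]
      exact Nat.find_min hex hk
    simp only [Nat.unpair_pair, K, if_pos hT]
    exact ⟨hA hx, rfl⟩
  · by_cases hq : T m.unpair
    · simpa only [K, if_pos hq] using hq.1
    · simpa only [K, if_neg hq] using hempty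

/-- Among pairwise disjoint intervals that cover an interval `J`, those meeting `J` but none of the
sets `J' l`, all disjoint from `J`, have an order connected union. -/
theorem ordConnected_biUnion_of_meets {κ ι : Type*} {P F : Finset κ} {I : κ → Set ℝ}
    (hI : ∀ p ∈ P, (I p).OrdConnected)
    (hdisj : ∀ p ∈ P, ∀ q ∈ P, p ≠ q → Disjoint (I p) (I q)) {J : Set ℝ} (hJ : J.OrdConnected)
    (hcov : J ⊆ ⋃ p ∈ P, I p) {J' : ι → Set ℝ} (hJ' : ∀ l, Disjoint J (J' l))
    (hF : ∀ p, p ∈ F ↔ p ∈ P ∧ (I p ∩ J).Nonempty ∧ ∀ l, ¬ (I p ∩ J' l).Nonempty) :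
    (⋃ p ∈ F, I p).OrdConnected := by
  refine ⟨fun x hx y hy z hz => ?_⟩
  obtain ⟨p, hp, hxp⟩ := Set.mem_iUnion₂.1 hx
  obtain ⟨q, hq, hyq⟩ := Set.mem_iUnion₂.1 hy
  obtain ⟨hpP, ⟨u, hup, huJ⟩, -⟩ := (hF p).1 hp
  obtain ⟨hqP, ⟨v, hvq, hvJ⟩, -⟩ := (hF q).1 hq
  by_cases hzp : z ∈ I p
  · exact Set.mem_iUnion₂.2 ⟨p, hp, hzp⟩
  by_cases hzq : z ∈ I q
  · exact Set.mem_iUnion₂.2 ⟨q, hq, hzq⟩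
  have huz : u ≤ z := by
    by_contra! hlt
    exact hzp ((hI p hpP).out hxp hup ⟨hz.1, hlt.le⟩)
  have hzv : z ≤ v := by
    by_contra! hlt
    exact hzq ((hI q hqP).out hvq hyq ⟨hlt.le, hz.2⟩)
  obtain ⟨t, ht, hzt⟩ := Set.mem_iUnion₂.1 (hcov (hJ.out huJ hvJ ⟨huz, hzv⟩))
  have htp : t ≠ p := fun e => hzp (e ▸ hzt)
  have htq : t ≠ q := fun e => hzq (e ▸ hzt)
  -- `I t` is trapped between `u` and `v`: extending past either point would make it meet `I p` or
  -- `I q`.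
  have hsub : I t ⊆ J := by
    refine fun w hw => hJ.out huJ hvJ ⟨?_, ?_⟩
    · by_contra! hlt
      exact Set.disjoint_left.1 (hdisj t ht p hpP htp) ((hI t ht).out hw hzt ⟨hlt.le, huz⟩) hup
    · by_contra! hlt
      exact Set.disjoint_left.1 (hdisj t ht q hqP htq) ((hI t ht).out hzt hw ⟨hzv, hlt.le⟩) hvq
  refine Set.mem_iUnion₂.2 ⟨t, (hF t).2 ⟨ht, ⟨z, hzt, hsub hzt⟩, fun l => ?_⟩, hzt⟩
  rintro ⟨w, hw, hwl⟩
  exact Set.disjoint_left.1 (hJ' l) (hsub hw) hwl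

/-- If `A` is locally covered by finite disjoint families of intervals of diameter at most `ρ` and
cost at most `a`, for ultrafilter-many indices, then its content at any larger scale is at most
`a`. -/
theorem content_le_of_locally_covered {ι κ : Type*} {U : Ultrafilter ι} {s : ℝ} (hs₀ : 0 ≤ s)
    (hs₁ : s ≤ 1) {ρ r a : ℝ≥0∞} (hρ : ρ < r) {P : ι → Finset κ} {I : ι → κ → Set ℝ}
    (hord : ∀ i, ∀ p ∈ P i, (I i p).OrdConnected)
    (hdisj : ∀ᶠ i in (U : Filter ι), ∀ p ∈ P i, ∀ q ∈ P i, p ≠ q → Disjoint (I i p) (I i q))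
    (hI : ∀ᶠ i in (U : Filter ι), ∀ p ∈ P i, Metric.ediam (I i p) ≤ ρ)
    (hcost : ∀ᶠ i in (U : Filter ι), ∑ p ∈ P i, Metric.ediam (I i p) ^ s ≤ a)
    {A : Set ℝ} (hA : A ⊆ Set.Icc 0 1)
    (hcov : ∀ x ∈ A, ∃ r > 0, ∀ᶠ i in (U : Filter ι),
      {z ∈ Set.Icc (0 : ℝ) 1 | |z - x| < r} ⊆ ⋃ p ∈ P i, I i p) :
    content s r A ≤ a := by
  classical
  obtain ⟨J, hJord, hJdisj, hJcov, hJ⟩ := exists_disjoint_cover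
    (good := fun t => ∀ᶠ i in (U : Filter ι), t ⊆ ⋃ p ∈ P i, I i p)
    (fun _ _ hst ht => ht.mono fun _ h => hst.trans h)
    (Eventually.of_forall fun _ => Set.empty_subset _) hA hcov
  let F : ℕ → ι → Finset κ := fun m i => {p ∈ P i | (I i p ∩ J m).Nonempty ∧
    ∀ l : Set.Iio m, ¬ (I i p ∩ J l).Nonempty}
  have hFord : ∀ m, ∀ᶠ i in (U : Filter ι), (⋃ p ∈ F m i, I i p).OrdConnected := by
    intro m
    filter_upwards [hdisj, hJ m] with i h1 h2
    exact ordConnected_biUnion_of_meets (hord i) h1 (hJord m) h2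
      (J' := fun l : Set.Iio m => J l) (fun l => hJdisj l.2.ne')
      (fun p => by simp only [F, Finset.mem_filter])
  -- By compactness of `[0, ∞]`, every ultrafilter on it converges.
  have hlim : ∀ m, ∃ c, Tendsto (fun i => ∑ p ∈ F m i, Metric.ediam (I i p) ^ s) U (𝓝 c) :=
    fun m => ⟨_, (U.map fun i => ∑ p ∈ F m i, Metric.ediam (I i p) ^ s).le_nhds_lim⟩
  choose c hc using hlim
  have hFdisj : ∀ i, Pairwise fun l m => Disjoint (F l i) (F m i) := by
    intro i
    refine (pairwise_disjoint_on fun l => F l i).2 fun l m hlm => ?_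
    refine Finset.disjoint_left.2 fun p hl hm => ?_
    exact (Finset.mem_filter.1 hm).2.2 ⟨l, hlm⟩ (Finset.mem_filter.1 hl).2.1
  have hsum : ∑' m, c m ≤ a := by
    rw [ENNReal.tsum_eq_iSup_sum]
    refine iSup_le fun S => le_of_tendsto (tendsto_finsetSum S fun m _ => hc m) ?_
    filter_upwards [hcost] with i hi
    rw [← Finset.sum_biUnion fun l _ m _ hlm => hFdisj i hlm]
    refine (Finset.sum_le_sum_of_subset ?_).trans hi
    exact Finset.biUnion_subset.2 fun m _ => Finset.filter_subset _ _
  have hAcov : A ⊆ ⋃ m, {x ∈ Set.Icc (0 : ℝ) 1 | ∀ᶠ i in (U : Filter ι),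
      x ∈ ⋃ p ∈ F m i, I i p} := by
    intro x hx
    obtain ⟨m, hm⟩ := Set.mem_iUnion.1 (hJcov hx)
    -- The cell containing `x` meets `J m`, so it is assigned to some `l ≤ m`. This `l` depends on
    -- `i`, but with finitely many choices the ultrafilter selects one.
    have hex : ∀ᶠ i in (U : Filter ι), ∃ l ∈ Set.Iic m, x ∈ ⋃ p ∈ F l i, I i p := by
      filter_upwards [hJ m] with i hi
      obtain ⟨p, hp, hxp⟩ := Set.mem_iUnion₂.1 (hi hm)
      have hex : ∃ l, (I i p ∩ J l).Nonempty := ⟨m, x, hxp, hm⟩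
      refine ⟨Nat.find hex, Nat.find_min' hex ⟨x, hxp, hm⟩, Set.mem_iUnion₂.2 ⟨p, ?_, hxp⟩⟩
      exact Finset.mem_filter.2 ⟨hp, Nat.find_spec hex, fun l => Nat.find_min hex l.2⟩
    obtain ⟨l, -, hl⟩ := (Ultrafilter.eventually_exists_mem_iff (Set.finite_Iic m)).1 hex
    exact Set.mem_iUnion.2 ⟨l, hA hx, hl⟩
  calc content s r A ≤ _ := measure_mono hAcov
    _ ≤ ∑' m, _ := measure_iUnion_le _
    _ ≤ ∑' m, c m := ENNReal.tsum_le_tsum fun m => content_le_of_tendsto hs₀ hs₁ hρ (hFord m)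
        (hI.mono fun i h p hp => h p (Finset.filter_subset _ _ hp)) (hc m)
    _ ≤ a := hsum

/-! ### Grid intervals and partitions -/

theorem mem_gridInterval {n : ℕ} (hn : 0 < n) {k : ℕ} {p : ℕ × ℕ} :
    (k : ℝ) / n ∈ gridInterval n p ↔ p.1 ≤ k ∧ k ≤ p.2 := by
  have hn' : (n : ℝ) ≠ 0 := by exact_mod_cast hn.ne'
  constructor
  · rintro ⟨l, h1, h2, h⟩
    have : k = l := by exact_mod_cast (div_left_inj' hn').1 h
    exact this ▸ ⟨h1, h2⟩
  · rintro ⟨h1, h2⟩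
    exact ⟨k, h1, h2, rfl⟩

theorem sum_insert_le_add {κ M : Type*} [DecidableEq κ] [AddCommMonoid M] [PartialOrder M]
    [IsOrderedAddMonoid M] [CanonicallyOrderedAdd M] (f : κ → M) (a : κ) (P : Finset κ) :
    ∑ p ∈ insert a P, f p ≤ f a + ∑ p ∈ P, f p := by
  by_cases h : a ∈ P
  · rw [Finset.insert_eq_of_mem h]; exact le_add_self
  · rw [Finset.sum_insert h]

theorem gridDiam_le_gridDiam {n : ℕ} {p q : ℕ × ℕ} (h1 : p.1 ≤ q.1) (h2 : q.2 ≤ p.2) :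
    gridDiam n q ≤ gridDiam n p := by
  have h1' : (p.1 : ℝ) ≤ q.1 := by exact_mod_cast h1
  have h2' : (q.2 : ℝ) ≤ p.2 := by exact_mod_cast h2
  unfold gridDiam
  gcongr

/-- Two overlapping intervals of a finite family can be replaced by smaller ones without changing
the union. -/
theorem exists_smaller_family {n : ℕ} {δ s : ℝ} (hs : 0 ≤ s) {P : Finset (ℕ × ℕ)}
    (hint : ∀ p ∈ P, p.1 ≤ p.2 ∧ p.2 ≤ n) (hdiam : ∀ p ∈ P, gridDiam n p ≤ δ) {p q : ℕ × ℕ}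
    (hp : p ∈ P) (hq : q ∈ P) (hpq : p ≠ q) (h1 : p.1 ≤ q.1) (h2 : q.1 ≤ p.2) :
    ∃ P' : Finset (ℕ × ℕ), (∀ p ∈ P', p.1 ≤ p.2 ∧ p.2 ≤ n) ∧ (∀ p ∈ P', gridDiam n p ≤ δ) ∧
      (⋃ p ∈ P', gridInterval n p) = (⋃ p ∈ P, gridInterval n p) ∧
      ∑ p ∈ P', ENNReal.ofReal (gridDiam n p) ^ s ≤ ∑ p ∈ P, ENNReal.ofReal (gridDiam n p) ^ s ∧
      ∑ p ∈ P', (p.2 - p.1 + 1) < ∑ p ∈ P, (p.2 - p.1 + 1) := by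
  have hpe : p ∈ P.erase q := Finset.mem_erase.2 ⟨hpq, hp⟩
  have hsub : P.erase q ⊆ P := Finset.erase_subset _ _
  rcases le_or_gt q.2 p.2 with h | h
  · refine ⟨P.erase q, fun t ht => hint t (hsub ht), fun t ht => hdiam t (hsub ht), ?_,
      Finset.sum_le_sum_of_subset hsub, ?_⟩
    · refine (Set.biUnion_subset_biUnion_left hsub).antisymm (Set.iUnion₂_subset fun t ht => ?_)
      by_cases htq : t = q
      · subst htq
        rintro _ ⟨k, hk1, hk2, rfl⟩
        exact Set.mem_iUnion₂.2 ⟨p, hpe, k, h1.trans hk1, hk2.trans h, rfl⟩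
      · exact Set.subset_biUnion_of_mem (u := gridInterval n) (Finset.mem_erase.2 ⟨htq, ht⟩)
    · rw [← Finset.add_sum_erase P _ hq]; omega
  · have hqP := hint q hq
    -- `q` sticks out beyond `p`; keep only the part to the right of `p`.
    set q' : ℕ × ℕ := (p.2 + 1, q.2) with hq'
    have hd : gridDiam n q' ≤ gridDiam n q := gridDiam_le_gridDiam (by simp [hq']; omega) le_rfl
    refine ⟨insert q' (P.erase q), ?_, ?_, ?_, ?_, ?_⟩
    · refine fun t ht => (Finset.mem_insert.1 ht).elim ?_ fun ht => hint t (hsub ht)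
      rintro rfl
      exact ⟨h, hqP.2⟩
    · refine fun t ht => (Finset.mem_insert.1 ht).elim ?_ fun ht => hdiam t (hsub ht)
      rintro rfl
      exact hd.trans (hdiam q hq)
    · refine (Set.iUnion₂_subset fun t ht => ?_).antisymm (Set.iUnion₂_subset fun t ht => ?_)
      · rcases Finset.mem_insert.1 ht with rfl | ht
        · rintro _ ⟨k, hk1, hk2, rfl⟩
          refine Set.mem_iUnion₂.2 ⟨q, hq, k, ?_, hk2, rfl⟩
          simp only [hq'] at hk1
          omega
        · exact Set.subset_biUnion_of_mem (u := gridInterval n) (hsub ht)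
      · by_cases htq : t = q
        · subst htq
          rintro _ ⟨k, hk1, hk2, rfl⟩
          rcases le_or_gt k p.2 with hk | hk
          · exact Set.mem_iUnion₂.2 ⟨p, Finset.mem_insert_of_mem hpe, k, h1.trans hk1, hk, rfl⟩
          · exact Set.mem_iUnion₂.2 ⟨q', Finset.mem_insert_self _ _, k, hk, hk2, rfl⟩
        · exact Set.subset_biUnion_of_mem (u := gridInterval n)
            (Finset.mem_insert_of_mem (Finset.mem_erase.2 ⟨htq, ht⟩))
    · refine (sum_insert_le_add _ _ _).trans ?_
      rw [← Finset.add_sum_erase P _ hq]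
      gcongr
    · refine (sum_insert_le_add _ _ _).trans_lt ?_
      rw [← Finset.add_sum_erase P _ hq]
      simp only [hq']
      omega

/-- A finite family of grid intervals can be made disjoint without increasing its cost. -/
theorem exists_isPartition_biUnion {n : ℕ} (hn : 0 < n) {δ s : ℝ} (hs : 0 ≤ s)
    (P : Finset (ℕ × ℕ)) (hint : ∀ p ∈ P, p.1 ≤ p.2 ∧ p.2 ≤ n)
    (hdiam : ∀ p ∈ P, gridDiam n p ≤ δ) :
    ∃ Q, IsPartition n δ (⋃ p ∈ P, gridInterval n p) Q ∧
      ∑ p ∈ Q, ENNReal.ofReal (gridDiam n p) ^ s ≤ ∑ p ∈ P, ENNReal.ofReal (gridDiam n p) ^ s := by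
  induction hm : ∑ p ∈ P, (p.2 - p.1 + 1) using Nat.strong_induction_on generalizing P with
  | _ m ih =>
    by_cases hd : ∀ p ∈ P, ∀ q ∈ P, p ≠ q → Disjoint (gridInterval n p) (gridInterval n q)
    · exact ⟨P, ⟨hint, hdiam, hd, rfl⟩, le_rfl⟩
    · push Not at hd
      obtain ⟨p, hp, q, hq, hpq, hmeet⟩ := hd
      obtain ⟨_, ⟨k, hk1, hk2, rfl⟩, hx⟩ := Set.not_disjoint_iff.1 hmeet
      obtain ⟨hk3, hk4⟩ := (mem_gridInterval hn).1 hx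
      obtain ⟨P', h1, h2, h3, h4, h5⟩ : ∃ P' : Finset (ℕ × ℕ),
          (∀ p ∈ P', p.1 ≤ p.2 ∧ p.2 ≤ n) ∧ (∀ p ∈ P', gridDiam n p ≤ δ) ∧
          (⋃ p ∈ P', gridInterval n p) = (⋃ p ∈ P, gridInterval n p) ∧
          ∑ p ∈ P', ENNReal.ofReal (gridDiam n p) ^ s ≤
            ∑ p ∈ P, ENNReal.ofReal (gridDiam n p) ^ s ∧
          ∑ p ∈ P', (p.2 - p.1 + 1) < ∑ p ∈ P, (p.2 - p.1 + 1) := by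
        rcases le_total p.1 q.1 with h | h
        · exact exists_smaller_family hs hint hdiam hp hq hpq h (by omega)
        · exact exists_smaller_family hs hint hdiam hq hp hpq.symm h (by omega)
      obtain ⟨Q, hQ, hQle⟩ := ih _ (hm ▸ h5) P' h1 h2 rfl
      exact ⟨Q, h3 ▸ hQ, hQle.trans h4⟩

/-- Upper bounds may thus use overlapping families, as obtained from an arbitrary cover. -/
theorem discreteMeasure_biUnion_le {n : ℕ} (hn : 0 < n) {δ s : ℝ} (hs : 0 ≤ s)
    (P : Finset (ℕ × ℕ)) (hint : ∀ p ∈ P, p.1 ≤ p.2 ∧ p.2 ≤ n)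
    (hdiam : ∀ p ∈ P, gridDiam n p ≤ δ) :
    discreteMeasure s n δ (⋃ p ∈ P, gridInterval n p) ≤
      ∑ p ∈ P, ENNReal.ofReal (gridDiam n p) ^ s := by
  obtain ⟨Q, hQ, hle⟩ := exists_isPartition_biUnion hn hs P hint hdiam
  exact (iInf₂_le Q hQ).trans hle

/-- The real interval `[i/n, (j+1)/n)` that corresponds to the grid interval coded by `(i, j)`. -/
def cell (n : ℕ) (p : ℕ × ℕ) : Set ℝ := Set.Ico ((p.1 : ℝ) / n) (((p.2 : ℝ) + 1) / n)

theorem ediam_cell (n : ℕ) (p : ℕ × ℕ) :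
    Metric.ediam (cell n p) = ENNReal.ofReal (gridDiam n p) := by
  rw [cell, Real.ediam_Ico, gridDiam]
  congr 1
  ring

/-- Rounding down to the grid translates membership in cells into membership in grid intervals,
which transfers disjointness and covering. -/
theorem mem_cell_iff {n : ℕ} (hn : 0 < n) {z : ℝ} (hz : 0 ≤ z) {p : ℕ × ℕ} :
    z ∈ cell n p ↔ p.1 ≤ ⌊z * n⌋₊ ∧ ⌊z * n⌋₊ ≤ p.2 := by
  have hn' : (0 : ℝ) < n := by exact_mod_cast hn
  have hzn : 0 ≤ z * n := by positivity
  rw [cell, Set.mem_Ico, div_le_iff₀ hn', lt_div_iff₀ hn', Nat.le_floor_iff hzn,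
    ← Nat.lt_succ_iff, Nat.floor_lt hzn, Nat.succ_eq_add_one, Nat.cast_add, Nat.cast_one]

theorem IsPartition.disjoint_cell {n : ℕ} (hn : 0 < n) {δ : ℝ} {B : Set ℝ} {P : Finset (ℕ × ℕ)}
    (h : IsPartition n δ B P) :
    ∀ p ∈ P, ∀ q ∈ P, p ≠ q → Disjoint (cell n p) (cell n q) := by
  intro p hp q hq hpq
  refine Set.disjoint_left.2 fun z hz hz' => ?_
  have hz0 : 0 ≤ z := le_trans (by positivity) hz.1
  exact Set.disjoint_left.1 (h.disjoint p hp q hq hpq)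
    ((mem_gridInterval hn).2 ((mem_cell_iff hn hz0).1 hz))
    ((mem_gridInterval hn).2 ((mem_cell_iff hn hz0).1 hz'))

theorem IsPartition.mem_biUnion_cell {n : ℕ} (hn : 0 < n) {δ : ℝ} {B : Set ℝ}
    {P : Finset (ℕ × ℕ)} (h : IsPartition n δ B P) {z : ℝ} (hz : 0 ≤ z)
    (hB : (⌊z * n⌋₊ : ℝ) / n ∈ B) : z ∈ ⋃ p ∈ P, cell n p := by
  rw [← h.cover] at hB
  obtain ⟨p, hp, hzp⟩ := Set.mem_iUnion₂.1 hB
  exact Set.mem_iUnion₂.2 ⟨p, hp, (mem_cell_iff hn hz).2 ((mem_gridInterval hn).1 hzp)⟩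

theorem grid_finite (n : ℕ) : (grid n).Finite := by
  refine ((Set.finite_Iic n).image fun k : ℕ => (k : ℝ) / n).subset ?_
  rintro _ ⟨k, hk, rfl⟩
  exact ⟨k, hk, rfl⟩

theorem grid_subset_Icc (n : ℕ) : grid n ⊆ Set.Icc 0 1 := by
  rintro _ ⟨k, hk, rfl⟩
  exact ⟨by positivity, div_le_one_of_le₀ (by exact_mod_cast hk) (by positivity)⟩

theorem gridInterval_subset_grid {n : ℕ} {p : ℕ × ℕ} (hp : p.2 ≤ n) :
    gridInterval n p ⊆ grid n := by
  rintro _ ⟨k, -, hk, rfl⟩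
  exact ⟨k, hk.trans hp, rfl⟩

/-! ### Standard parts -/

variable {U : Ultrafilter ℕ}

/-- The embedding of the reals into the hyperreals. -/
noncomputable def constHom (U : Ultrafilter ℕ) : ℝ →+*o Germ (U : Filter ℕ) ℝ where
  toFun x := Germ.const x
  map_zero' := rfl
  map_one' := rfl
  map_add' _ _ := rfl
  map_mul' _ _ := rfl
  monotone' _ _ h := Germ.const_le h

theorem stdPart_eq_of_tendsto {y : ℕ → ℝ} {x : ℝ} (h : Tendsto y U (𝓝 x)) :
    ArchimedeanClass.stdPart (y : Germ (U : Filter ℕ) ℝ) = x := by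
  refine ArchimedeanClass.stdPart_eq (constHom U) (fun a ha => ?_) (fun a ha => ?_)
  · exact Germ.coe_le.2 ((h.eventually_const_lt ha).mono fun _ => le_of_lt)
  · exact Germ.coe_le.2 ((h.eventually_lt_const ha).mono fun _ => le_of_lt)

theorem tendsto_stdPart {y : ℕ → ℝ} (h : ∀ᶠ i in (U : Filter ℕ), y i ∈ Set.Icc (0 : ℝ) 1) :
    Tendsto y U (𝓝 (ArchimedeanClass.stdPart (y : Germ (U : Filter ℕ) ℝ))) := by
  obtain ⟨x, -, hx⟩ := isCompact_Icc.ultrafilter_le_nhds' (U.map y) h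
  have hx' : Tendsto y U (𝓝 x) := hx
  rwa [stdPart_eq_of_tendsto hx']

theorem eventually_lt_of_isInfinite {n : ℕ → ℕ}
    (hN : IsInfinite (n : Germ (U : Filter ℕ) ℕ)) (m : ℕ) :
    ∀ᶠ i in (U : Filter ℕ), m < n i :=
  Germ.coe_lt.1 (hN m)

theorem eventually_inv_lt {n : ℕ → ℕ} (hN : IsInfinite (n : Germ (U : Filter ℕ) ℕ)) {ε : ℝ}
    (hε : 0 < ε) : ∀ᶠ i in (U : Filter ℕ), (n i : ℝ)⁻¹ < ε := by
  obtain ⟨m, hm⟩ := exists_nat_gt ε⁻¹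
  filter_upwards [eventually_lt_of_isInfinite hN m] with i hi
  refine inv_lt_of_inv_lt₀ hε (hm.trans ?_)
  exact_mod_cast hi

/-! ### The lower bound -/

/-- An internal set that contains all grid points infinitely close to `x` contains all grid points
within some standard distance of `x`. -/
theorem exists_forall_grid_mem {n : ℕ → ℕ} {B : ℕ → Set ℝ} {A : Set ℝ}
    (hB : stInv (n : Germ (U : Filter ℕ) ℕ) A ⊆ internalSet (B : Germ (U : Filter ℕ) (Set ℝ)))
    {x : ℝ} (hx : x ∈ A) :
    ∃ r > 0, ∀ᶠ i in (U : Filter ℕ), ∀ y ∈ grid (n i), |y - x| < r → y ∈ B i := by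
  by_contra! hcon
  -- A missing grid point nearest to `x` serves all radii at once: if the claim fails, these points
  -- form an element of `st⁻¹(A)` outside the internal set.
  have hmin : ∀ i, ∃ y, (grid (n i) \ B i).Nonempty →
      y ∈ grid (n i) \ B i ∧ ∀ z ∈ grid (n i) \ B i, |y - x| ≤ |z - x| := by
    intro i
    by_cases hne : (grid (n i) \ B i).Nonempty
    · obtain ⟨y, hy, hle⟩ := Set.exists_min_image _ (fun y => |y - x|)
        ((grid_finite (n i)).subset Set.sdiff_subset) hne
      exact ⟨y, fun _ => ⟨hy, hle⟩⟩
    · exact ⟨0, fun h => absurd h hne⟩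
  choose y hy using hmin
  have hyB : ∀ᶠ i in (U : Filter ℕ), y i ∈ grid (n i) \ B i := by
    filter_upwards [hcon 1 one_pos] with i hi
    obtain ⟨z, hz, -, hzB⟩ := hi
    exact (hy i ⟨z, hz, hzB⟩).1
  have hlim : Tendsto y U (𝓝 x) := by
    refine Metric.tendsto_nhds.2 fun r hr => ?_
    filter_upwards [hcon r hr] with i hi
    obtain ⟨z, hz, hzr, hzB⟩ := hi
    exact ((hy i ⟨z, hz, hzB⟩).2 z ⟨hz, hzB⟩).trans_lt hzr
  have hmem : (y : Germ (U : Filter ℕ) ℝ) ∈ internalSet (B : Germ (U : Filter ℕ) (Set ℝ)) := by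
    refine hB ⟨?_, ?_⟩
    · exact hyB.mono fun i hi => hi.1
    · rw [stdPart_eq_of_tendsto hlim]; exact hx
  have hmem' : ∀ᶠ i in (U : Filter ℕ), y i ∈ B i := hmem
  obtain ⟨i, h1, h2⟩ := (hyB.and hmem').exists
  exact h1.2 h2

theorem content_le_outerValue {s : ℝ} (hs₀ : 0 ≤ s) (hs₁ : s ≤ 1) {A : Set ℝ}
    (hA : A ⊆ Set.Icc 0 1) {N : Germ (U : Filter ℕ) ℕ} (hN : IsInfinite N)
    {δ : Germ (U : Filter ℕ) ℝ} {δ₀ : ℝ} (hδ : δ ≤ (Germ.const δ₀ : Germ (U : Filter ℕ) ℝ))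
    {r : ℝ≥0∞} (hr : ENNReal.ofReal δ₀ < r) :
    content s r A ≤ outerValue s N δ A := by
  induction N using Germ.inductionOn with | _ n
  induction δ using Germ.inductionOn with | _ d
  refine le_iInf fun B => ?_
  induction B using Germ.inductionOn with | _ B
  refine le_iInf₂ fun _ hB => le_iInf₂ fun a ha => ?_
  have hle : ∀ᶠ i in (U : Filter ℕ), discreteMeasure s (n i) (d i) (B i) ≤ a := ha
  have hd : ∀ᶠ i in (U : Filter ℕ), d i ≤ δ₀ := hδ
  have hex : ∀ i, ∃ P, discreteMeasure s (n i) (d i) (B i) ≤ a →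
      IsPartition (n i) (d i) (B i) P ∧ ∑ p ∈ P, ENNReal.ofReal (gridDiam (n i) p) ^ s ≤ a := by
    intro i
    by_cases hP : ∃ P, IsPartition (n i) (d i) (B i) P
    · obtain ⟨P, h1, h2⟩ := exists_discreteMeasure_eq s _ _ _ hP
      exact ⟨P, fun h => ⟨h1, h2 ▸ h⟩⟩
    -- Without a partition the infimum is `∞`, contradicting the finite bound `a`.
    · refine ⟨∅, fun h => absurd (h.trans_lt ENNReal.coe_lt_top) ?_⟩
      push Not at hP
      simp [discreteMeasure, hP]
  choose P hP using hex
  have hpart := hle.mono fun i hi => (hP i hi).1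
  have hpos := eventually_lt_of_isInfinite hN 0
  refine content_le_of_locally_covered hs₀ hs₁ hr (P := P) (I := fun i => cell (n i))
    (U := U) (fun i p _ => Set.ordConnected_Ico) ?_ ?_ ?_ hA ?_
  · filter_upwards [hpart, hpos] with i h1 h2 using h1.disjoint_cell h2
  · filter_upwards [hpart, hd] with i h1 h2 p hp
    rw [ediam_cell]
    exact ENNReal.ofReal_le_ofReal ((h1.diam_le p hp).trans h2)
  · filter_upwards [hle] with i hi
    simpa only [ediam_cell] using (hP i hi).2
  · intro x hx
    obtain ⟨ε, hε, hev⟩ := exists_forall_grid_mem hB hx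
    -- The other half of `ε` absorbs the rounding error, which is less than `1/n`.
    refine ⟨ε / 2, half_pos hε, ?_⟩
    filter_upwards [hpart, hpos, hev, eventually_inv_lt hN (half_pos hε)] with i h1 h2 h3 h4
    rintro z ⟨hz, hzx⟩
    have hn : (0 : ℝ) < n i := by exact_mod_cast h2
    have hzn : 0 ≤ z * n i := mul_nonneg hz.1 hn.le
    refine h1.mem_biUnion_cell h2 hz.1 (h3 _ ⟨_, ?_, rfl⟩ ?_)
    · exact Nat.floor_le_of_le (mul_le_of_le_one_left hn.le hz.2)
    · have e1 : (⌊z * n i⌋₊ : ℝ) / n i ≤ z := by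
        rw [div_le_iff₀ hn]; exact Nat.floor_le hzn
      have e2 : z < (⌊z * n i⌋₊ : ℝ) / n i + (n i : ℝ)⁻¹ := by
        rw [inv_eq_one_div, ← add_div, lt_div_iff₀ hn]; exact Nat.lt_floor_add_one _
      rw [abs_lt] at hzx ⊢
      constructor <;> linarith

/-! ### The upper bound -/

/-- The grid points in `[u, v]` form a grid interval of discrete diameter at most
`v - u + 1/n`. -/
theorem gridDiam_ceil_floor_le {n : ℕ} (hn : 0 < n) {u v : ℝ} (hv : 0 ≤ v) :
    gridDiam n (⌈u * n⌉₊, min n ⌊v * n⌋₊) ≤ v - u + (n : ℝ)⁻¹ := by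
  have hn' : (0 : ℝ) < n := by exact_mod_cast hn
  have h1 : u * n ≤ (⌈u * n⌉₊ : ℝ) := Nat.le_ceil _
  have h2 : ((min n ⌊v * n⌋₊ : ℕ) : ℝ) ≤ v * n :=
    (Nat.cast_le.2 (min_le_right _ _)).trans (Nat.floor_le (by positivity))
  rw [gridDiam, div_le_iff₀ hn']
  have h3 : (v - u + (n : ℝ)⁻¹) * n = v * n - u * n + 1 := by field_simp
  rw [h3]
  simp only
  linarith

/-- A small enlargement of a bounded set changes `diam ^ s` as little as desired. -/
theorem exists_pos_add_rpow_le (s : ℝ) {d : ℝ} {η : ℝ≥0∞} (hη : 0 < η) {δ : ℝ} (hδ : 0 < δ)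
    (hs : 0 ≤ s) :
    ∃ ε > 0, 3 * ε ≤ δ ∧ ENNReal.ofReal (d + 3 * ε) ^ s ≤ ENNReal.ofReal d ^ s + η := by
  have hfin : ENNReal.ofReal d ^ s ≠ ∞ := ENNReal.rpow_ne_top_of_nonneg hs ENNReal.ofReal_ne_top
  have hlt : ENNReal.ofReal d ^ s < ENNReal.ofReal d ^ s + η := ENNReal.lt_add_right hfin hη.ne'
  have hcont : Continuous fun ε : ℝ => ENNReal.ofReal (d + 3 * ε) ^ s :=
    ENNReal.continuous_rpow_const.comp (ENNReal.continuous_ofReal.comp (by fun_prop))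
  have hlim : Tendsto (fun ε : ℝ => ENNReal.ofReal (d + 3 * ε) ^ s) (𝓝[>] 0)
      (𝓝 (ENNReal.ofReal d ^ s)) := by
    have := hcont.tendsto 0
    simp only [mul_zero, add_zero] at this
    exact this.mono_left nhdsWithin_le_nhds
  obtain ⟨ε, h1, h2, h3⟩ := ((hlim.eventually_lt_const hlt).and
    (Ioo_mem_nhdsGT (show (0 : ℝ) < δ / 3 by positivity))).exists
  exact ⟨ε, h2, by linarith, h1.le⟩

theorem outerValue_le_hausdorffMeasure (hU : ∀ n : ℕ, {n} ∉ U) {s : ℝ} (hs₀ : 0 ≤ s)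
    {A : Set ℝ} (hA : A ⊆ Set.Icc 0 1) {N : Germ (U : Filter ℕ) ℕ} (hN : IsInfinite N) {δ : ℝ}
    (hδ : 0 < δ) :
    outerValue s N (Germ.const δ) A ≤ μH[s] A := by
  classical
  induction N using Germ.inductionOn with | _ n
  refine le_of_forall_gt_imp_ge_of_dense fun c hc => ?_
  obtain ⟨t, hAt, htd, htc⟩ : ∃ t : ℕ → Set ℝ, A ⊆ (⋃ k, t k) ∧
      (∀ k, Metric.ediam (t k) ≤ ENNReal.ofReal (δ / 2)) ∧
      ∑' k, ⨆ _ : (t k).Nonempty, Metric.ediam (t k) ^ s < c := by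
    rw [Measure.hausdorffMeasure_apply] at hc
    have h := (le_iSup₂ (f := fun (r : ℝ≥0∞) (_ : 0 < r) =>
      ⨅ (t : ℕ → Set ℝ) (_ : A ⊆ ⋃ n, t n) (_ : ∀ n, Metric.ediam (t n) ≤ r),
        ∑' n, ⨆ _ : (t n).Nonempty, Metric.ediam (t n) ^ s) (ENNReal.ofReal (δ / 2))
      (ENNReal.ofReal_pos.2 (half_pos hδ))).trans_lt hc
    simpa only [iInf_lt_iff, exists_prop] using h
  obtain ⟨η, hη, hηc⟩ := ENNReal.exists_pos_sum_of_countable' (tsub_pos_iff_lt.2 htc).ne' ℕ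
  have hbdd : ∀ k, Bornology.IsBounded (t k) := fun k =>
    Metric.isBounded_iff_ediam_ne_top.2 ((htd k).trans_lt ENNReal.ofReal_lt_top).ne
  set u : ℕ → ℝ := fun k => sInf (t k)
  set v : ℕ → ℝ := fun k => sSup (t k)
  have hdiam : ∀ k, Metric.ediam (t k) = ENNReal.ofReal (v k - u k) := fun k =>
    Real.ediam_eq (hbdd k)
  have hvu : ∀ k, v k - u k ≤ δ / 2 := fun k => by
    have := htd k
    rwa [hdiam, ENNReal.ofReal_le_ofReal_iff (half_pos hδ).le] at this
  -- The `3 * ε k` accounts for `ε k` on each side and at most `ε k` for the extra `1/n` in the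
  -- discrete diameter. It is at most `δ / 2`, so total diameters stay below `δ`.
  choose ε hε hεδ hεη using fun k =>
    exists_pos_add_rpow_le s (d := v k - u k) (hη k) (half_pos hδ) hs₀
  let g : ℕ → ℕ → ℕ × ℕ := fun i k =>
    (⌈(u k - ε k) * n i⌉₊, min (n i) ⌊(v k + ε k) * n i⌋₊)
  -- Empty `t k` are dropped because they cost nothing even for `s = 0`. The condition `0 ≤ v k`
  -- keeps the truncated floor from exceeding the true value.
  let S : ℕ → Finset ℕ := fun i => {k ∈ Finset.range i | (t k).Nonempty ∧ 0 ≤ v k ∧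
    (n i : ℝ)⁻¹ ≤ ε k ∧ (g i k).1 ≤ (g i k).2}
  have hgd : ∀ i, 0 < n i → ∀ k ∈ S i, gridDiam (n i) (g i k) ≤ v k - u k + 3 * ε k := by
    intro i hi k hk
    obtain ⟨-, -, hv, hn, -⟩ := Finset.mem_filter.1 hk
    have := gridDiam_ceil_floor_le hi (u := u k - ε k) (add_nonneg hv (hε k).le)
    linarith
  let P : ℕ → Finset (ℕ × ℕ) := fun i => (S i).image (g i)
  have hint : ∀ i, ∀ p ∈ P i, p.1 ≤ p.2 ∧ p.2 ≤ n i := by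
    intro i p hp
    obtain ⟨k, hk, rfl⟩ := Finset.mem_image.1 hp
    exact ⟨(Finset.mem_filter.1 hk).2.2.2.2, min_le_left _ _⟩
  let B : ℕ → Set ℝ := fun i => ⋃ p ∈ P i, gridInterval (n i) p
  have hBle : ∀ i, 0 < n i → discreteMeasure s (n i) δ (B i) ≤ c := by
    intro i hi
    refine (discreteMeasure_biUnion_le hi hs₀ (P i) (hint i) ?_).trans ?_
    · intro p hp
      obtain ⟨k, hk, rfl⟩ := Finset.mem_image.1 hp
      linarith [hgd i hi k hk, hεδ k, hvu k]
    calc ∑ p ∈ P i, ENNReal.ofReal (gridDiam (n i) p) ^ s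
        ≤ ∑ k ∈ S i, ENNReal.ofReal (gridDiam (n i) (g i k)) ^ s :=
          Finset.sum_image_le_of_nonneg fun _ _ => zero_le
      _ ≤ ∑ k ∈ S i, ((⨆ _ : (t k).Nonempty, Metric.ediam (t k) ^ s) + η k) := by
          refine Finset.sum_le_sum fun k hk => ?_
          have hne : (t k).Nonempty := (Finset.mem_filter.1 hk).2.1
          rw [ciSup_pos hne, hdiam]
          exact (ENNReal.rpow_le_rpow (ENNReal.ofReal_le_ofReal (hgd i hi k hk)) hs₀).trans (hεη k)
      _ ≤ ∑' k, ((⨆ _ : (t k).Nonempty, Metric.ediam (t k) ^ s) + η k) := ENNReal.sum_le_tsum _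
      _ = (∑' k, ⨆ _ : (t k).Nonempty, Metric.ediam (t k) ^ s) + ∑' k, η k := ENNReal.tsum_add
      _ ≤ _ + (c - _) := by gcongr
      _ = c := add_tsub_cancel_of_le htc.le
  have hpos := eventually_lt_of_isInfinite hN 0
  refine (iInf_le _ (B : Germ (U : Filter ℕ) (Set ℝ))).trans
    ((iInf₂_le ?_ ?_).trans ?_)
  · intro y
    induction y using Germ.inductionOn with | _ y
    intro hy
    have hy' : ∀ᶠ i in (U : Filter ℕ), y i ∈ B i := hy
    refine hy'.mono fun i hi => ?_
    obtain ⟨p, hp, hyp⟩ := Set.mem_iUnion₂.1 hi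
    exact gridInterval_subset_grid (hint i p hp).2 hyp
  · intro y
    induction y using Germ.inductionOn with | _ y
    rintro ⟨hy, hyA⟩
    have hy' : ∀ᶠ i in (U : Filter ℕ), y i ∈ grid (n i) := hy
    have hlim := tendsto_stdPart (hy'.mono fun i hi => grid_subset_Icc _ hi)
    set x := ArchimedeanClass.stdPart (y : Germ (U : Filter ℕ) ℝ)
    obtain ⟨k, hk⟩ := Set.mem_iUnion.1 (hAt hyA)
    have hux : u k ≤ x := csInf_le (hbdd k).bddBelow hk
    have hxv : x ≤ v k := le_csSup (hbdd k).bddAbove hk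
    have hv : 0 ≤ v k := (hA hyA).1.trans hxv
    have hlarge : ∀ᶠ i in (U : Filter ℕ), k < i := by
      have : ∀ᶠ i in (U : Filter ℕ), ∀ j ∈ Set.Iic k, i ≠ j :=
        (eventually_all_finite (Set.finite_Iic k)).2 fun j _ =>
          Ultrafilter.compl_mem_iff_notMem.2 (hU j)
      exact this.mono fun i hi => not_le.1 fun h => hi i h rfl
    change ∀ᶠ i in (U : Filter ℕ), y i ∈ B i
    filter_upwards [hlarge, hpos, eventually_inv_lt hN (hε k), hy',
      hlim.eventually_const_lt (show u k - ε k < x by linarith [hε k]),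
      hlim.eventually_lt_const (show x < v k + ε k by linarith [hε k])] with i h1 h2 h3 h4 h5 h6
    obtain ⟨m, hm, hym⟩ := h4
    have hn : (0 : ℝ) < n i := by exact_mod_cast h2
    have hyn : y i * n i = m := by rw [hym]; field_simp
    have hm1 : (g i k).1 ≤ m := by
      refine Nat.ceil_le.2 ?_
      rw [← hyn]; gcongr
    have hm2 : m ≤ (g i k).2 := by
      refine le_min hm (Nat.le_floor ?_)
      rw [← hyn]; gcongr
    refine Set.mem_iUnion₂.2 ⟨g i k, Finset.mem_image_of_mem _ ?_, m, hm1, hm2, hym⟩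
    exact Finset.mem_filter.2 ⟨Finset.mem_range.2 h1, ⟨x, hk⟩, hv, h3.le, hm1.trans hm2⟩
  · induction c with
    | top => exact le_top
    | coe c => exact iInf₂_le c (hpos.mono hBle)

end DiscreteHausdorff

theorem theorem5p2p2 (U : Ultrafilter ℕ) (hU : ∀ n : ℕ, {n} ∉ U)
    (s : ℝ) (hs₀ : 0 ≤ s) (hs₁ : s ≤ 1) (A : Set ℝ) (hA : A ⊆ Set.Icc 0 1) :
    (∀ N : Germ (U : Filter ℕ) ℕ, DiscreteHausdorff.IsInfinite N →
      (∀ δ : Germ (U : Filter ℕ) ℝ, DiscreteHausdorff.IsPosInfinitesimal δ →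
        μH[s] A ≤ DiscreteHausdorff.outerValue s N δ A) ∧
      Tendsto (fun δ : ℝ => DiscreteHausdorff.outerValue s N (Germ.const δ) A)
        (𝓝[>] (0 : ℝ)) (𝓝 (μH[s] A))) ∧
    (∀ N N' : Germ (U : Filter ℕ) ℕ,
      DiscreteHausdorff.IsInfinite N → DiscreteHausdorff.IsInfinite N' →
        DiscreteHausdorff.nonstandardHausdorff s N A =
          DiscreteHausdorff.nonstandardHausdorff s N' A) := by
  have hlim : ∀ N : Germ (U : Filter ℕ) ℕ, DiscreteHausdorff.IsInfinite N →
      Tendsto (fun δ : ℝ => DiscreteHausdorff.outerValue s N (Germ.const δ) A)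
        (𝓝[>] (0 : ℝ)) (𝓝 (μH[s] A)) := by
    intro N hN
    refine tendsto_order.2 ⟨fun a ha => ?_, fun a ha => ?_⟩
    · rw [DiscreteHausdorff.hausdorffMeasure_eq_iSup_content] at ha
      obtain ⟨r, ha⟩ := lt_iSup_iff.1 ha
      obtain ⟨hr, ha⟩ := lt_iSup_iff.1 ha
      have hof : Tendsto ENNReal.ofReal (𝓝[>] 0) (𝓝 0) := by
        have := ENNReal.continuous_ofReal.tendsto 0
        rw [ENNReal.ofReal_zero] at this
        exact this.mono_left nhdsWithin_le_nhds
      filter_upwards [hof.eventually_lt_const hr] with δ hδ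
      exact ha.trans_le (DiscreteHausdorff.content_le_outerValue hs₀ hs₁ hA hN le_rfl hδ)
    · filter_upwards [self_mem_nhdsWithin] with δ hδ
      exact (DiscreteHausdorff.outerValue_le_hausdorffMeasure hU hs₀ hA hN hδ).trans_lt ha
  refine ⟨fun N hN => ⟨fun δ hδ => ?_, hlim N hN⟩, fun N N' hN hN' => ?_⟩
  · rw [DiscreteHausdorff.hausdorffMeasure_eq_iSup_content]
    refine iSup₂_le fun r hr => ?_
    -- The infinitesimal `δ` lies below any standard positive `δ₀`, in particular one below `r`.
    obtain ⟨δ₀, hδ₀, hδr⟩ := ENNReal.lt_iff_exists_real_btwn.1 hr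
    exact DiscreteHausdorff.content_le_outerValue hs₀ hs₁ hA hN
      (hδ.2 δ₀ (ENNReal.ofReal_pos.1 hδr.1)).le hδr.2
  · exact (hlim N hN).limUnder_eq.trans (hlim N' hN').limUnder_eq.symm
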